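/- Let $n\ge 0$ be an integer, let $Q_0,\dots,Q_n\in\mathbb{C}[z]$ be polynomials, and suppose that there is an index $\ell$, $0\le \ell\le n$, such that $$\deg Q_\ell>\max_{\substack{0\le j\le n\\ j\ne \ell}}\deg Q_j ,$$ where the zero polynomial has degree $-\infty$ and the maximum of the empty set is $-\infty$. Let $f$ be a meromorphic function on $\mathbb{C}$, not identically zero, that solves $$Q_n(z)\,y(z+n)+\cdots+Q_1(z)\,y(z+1)+Q_0(z)\,y(z)=0$$ as an identity of meromorphic functions on $\mathbb{C}$. Then $\sigma(f)\ge 1$, where $$\sigma(f)=\limsup_{r\to\infty}\frac{\log^+T(r,f)}{\log r}\in[0,+\infty]$$ is the order of growth of $f$ and $T(r,f)=m(r,f)+N(r,f)$ is its Nevanlinna characteristic. -/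

import Mathlib

open Filter Polynomial

noncomputable section

/-- The (Nevanlinna) order of growth `σ(f) = limsup_{r → ∞} log⁺ T(r, f) / log r` of a meromorphic
function `f` on the complex plane, as an extended real number. Here `T(r, f) = m(r, f) + N(r, f)`
is the Nevanlinna characteristic of `f`, that is, the characteristic function for the value `∞`. -/
def nevanlinnaOrder (f : ℂ → ℂ) : EReal :=
  limsup (fun r : ℝ =>
    ((Real.posLog (ValueDistribution.characteristic f ⊤ r) / Real.log r : ℝ) : EReal)) atTop

/-- Equality of meromorphic functions on the complex plane: the functions agree off a closed
discrete set. (The values that a meromorphic function is given at its poles are immaterial.) -/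
def MeromorphicEq (f g : ℂ → ℂ) : Prop :=
  f =ᶠ[codiscrete ℂ] g

end

/-! If `σ(f) < 1`, then `T(r, f) ≤ r ^ ρ` eventually, for some `ρ < 1`. At a point `iy` far up the
imaginary axis where the moduli `|f(iy + j)|`, `0 ≤ j ≤ n`, agree up to a factor `e`, the term with
`Q_l` outweighs all the others together, so the equation fails. It remains to find such points.

On `|z| ≤ R = 6M`, write `log|f| = ∑ D(u) log|z - u| + log|g|` with `g` analytic and zero-free. The
Herglotz–Riesz kernel bounds the change of `log|g|` over a distance at most `n` by `O(R ^ (ρ - 1)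
log R)`. There are `O(R ^ ρ)` zeros and poles with multiplicity, and each changes by at most a
constant times `|y - Im u| ^ (-α)`, where `ρ < α < 1`. Averaging over `y ∈ [M, 2M]` gives a `y` with
total `O(M ^ (ρ - α))`. Both bounds tend to zero. -/

theorem Set.Countable.sdiff_of_mem_codiscreteWithin {U S : Set ℂ} (h : S ∈ codiscreteWithin U) :
    (U \ S).Countable := by
  have : DiscreteTopology ↑(Sᶜ ∩ U) := isDiscrete_iff_discreteTopology.mp
    <| isDiscrete_of_codiscreteWithin ((compl_compl S).symm ▸ h)
  rw [Set.sdiff_eq, Set.inter_comm]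
  exact TopologicalSpace.separableSpace_iff_countable.1 inferInstance

/-! ### Counting zeros and poles -/

open Set Metric Function Function.locallyFinsuppWithin in
theorem Function.locallyFinsuppWithin.sum_mul_log_two_le_logCounting
    {D : locallyFinsupp ℂ ℤ} (hD : 0 ≤ D) {R : ℝ} (hR : 1 ≤ R) {s : Finset ℂ}
    (hs : ∀ u ∈ s, ‖u‖ ≤ R) :
    ∑ u ∈ s, (D u : ℝ) * Real.log 2 ≤ logCounting D (2 * R) := by
  classical
  have hD' : ∀ u, (0 : ℝ) ≤ D u := fun u => by exact_mod_cast hD u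
  have hpos : ∀ u, 0 ≤ (D.toClosedBall (2 * R) u : ℝ) * Real.log (2 * R * ‖u‖⁻¹) := by
    intro u
    by_cases hu : u ∈ closedBall (0 : ℂ) |2 * R|
    · rw [toClosedBall_eval_within _ hu]
      refine mul_nonneg (hD' u) ?_
      rcases eq_or_ne u 0 with rfl | h0
      · simp
      · apply Real.log_nonneg
        rw [← div_eq_mul_inv, le_div_iff₀ (norm_pos_iff.2 h0), one_mul]
        rw [abs_of_pos (by linarith)] at hu
        simpa using hu
    · rw [apply_eq_zero_of_notMem _ hu]; simp
  have hfin : (D.toClosedBall (2 * R)).support.Finite :=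
    (D.toClosedBall (2 * R)).finiteSupport (isCompact_closedBall 0 |2 * R|)
  have hle : ∑ u ∈ s, (D.toClosedBall (2 * R) u : ℝ) * Real.log (2 * R * ‖u‖⁻¹) ≤
      ∑ᶠ u, (D.toClosedBall (2 * R) u : ℝ) * Real.log (2 * R * ‖u‖⁻¹) := by
    rw [finsum_eq_sum_of_support_subset (s := s ∪ hfin.toFinset)]
    · exact Finset.sum_le_sum_of_subset_of_nonneg Finset.subset_union_left
        fun u _ _ => hpos u
    · intro u hu
      have : D.toClosedBall (2 * R) u ≠ 0 := by
        intro h; simp [h] at hu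
      simp [this]
  have hlog2 : 0 ≤ Real.log 2 := Real.log_nonneg (by norm_num)
  -- At `u = 0` the logarithm takes the default value `0`; the origin is counted by the separate
  -- term with `log (2 * R)`.
  have hterm : ∀ u ∈ s, (D u : ℝ) * Real.log 2 ≤
      (D.toClosedBall (2 * R) u : ℝ) * Real.log (2 * R * ‖u‖⁻¹) +
        if u = 0 then (D 0 : ℝ) * Real.log (2 * R) else 0 := by
    intro u hu
    rcases eq_or_ne u 0 with rfl | h0
    · simp only [norm_zero, inv_zero, mul_zero, Real.log_zero, zero_add, if_true]
      exact mul_le_mul_of_nonneg_left (Real.log_le_log (by norm_num) (by linarith)) (hD' 0)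
    · have hmem : u ∈ closedBall (0 : ℂ) |2 * R| := by
        rw [abs_of_pos (by linarith)]
        simpa using (hs u hu).trans (by linarith)
      rw [toClosedBall_eval_within _ hmem, if_neg h0, add_zero]
      refine mul_le_mul_of_nonneg_left (Real.log_le_log (by norm_num) ?_) (hD' u)
      rw [← div_eq_mul_inv, le_div_iff₀ (norm_pos_iff.2 h0)]
      linarith [hs u hu]
  have hite : ∑ u ∈ s, (if u = 0 then (D 0 : ℝ) * Real.log (2 * R) else 0) ≤
      (D 0 : ℝ) * Real.log (2 * R) := by
    rw [Finset.sum_ite_eq']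
    have : 0 ≤ (D 0 : ℝ) * Real.log (2 * R) :=
      mul_nonneg (hD' 0) (Real.log_nonneg (by linarith))
    split_ifs <;> linarith
  calc _ ≤ _ := Finset.sum_le_sum hterm
    _ ≤ _ := by
      rw [Finset.sum_add_distrib]
      exact add_le_add hle hite

/-! ### Oscillation of the harmonic part and of the logarithmic kernels -/

open Metric InnerProductSpace Real in
theorem InnerProductSpace.HarmonicOnNhd.abs_sub_le_mul_circleAverage_abs {u : ℂ → ℝ} {R : ℝ}
    (hR : 0 < R) (hu : HarmonicOnNhd u (closedBall 0 R)) {w₁ w₂ : ℂ}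
    (h₁ : ‖w₁‖ ≤ R / 2) (h₂ : ‖w₂‖ ≤ R / 2) :
    |u w₁ - u w₂| ≤ 8 * ‖w₁ - w₂‖ / R * circleAverage (fun z => |u z|) 0 R := by
  have hb : ∀ {w : ℂ}, ‖w‖ ≤ R / 2 → w ∈ ball (0 : ℂ) R := fun h => by
    simpa using h.trans_lt (by linarith)
  have hcont : ContinuousOn u (sphere 0 |R|) := by
    rw [abs_of_pos hR]; exact hu.continuousOn.mono sphere_subset_closedBall
  have hint : ∀ {w : ℂ}, ‖w‖ ≤ R / 2 →
      ContinuousOn ((Complex.re ∘ herglotzRieszKernel 0 w) • u) (sphere 0 |R|) := fun h =>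
    (Complex.continuous_re.comp_continuousOn
      (continuousOn_herglotzRieszKernel_sphere (hb h))).smul hcont
  rw [← hu.circleAverage_re_herglotzRieszKernel_smul (hb h₁),
    ← hu.circleAverage_re_herglotzRieszKernel_smul (hb h₂),
    ← circleAverage_sub (hint h₁).circleIntegrable' (hint h₂).circleIntegrable',
    ← smul_eq_mul, ← circleAverage_fun_smul (f := fun z => |u z|)]
  refine abs_circleAverage_le_circleAverage_abs.trans (circleAverage_mono ?_ ?_ ?_)
  · exact (((hint h₁).sub (hint h₂)).abs).circleIntegrable'
  · exact (hcont.abs.const_smul (8 * ‖w₁ - w₂‖ / R)).circleIntegrable'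
  · intro z hz
    rw [abs_of_pos hR] at hz
    have hzR : ‖z‖ = R := by simpa using hz
    have key : ∀ {w : ℂ}, ‖w‖ ≤ R / 2 → R / 2 ≤ ‖z - w‖ := fun h => by
      linarith [norm_sub_norm_le z ‹ℂ›]
    have hne : ∀ {w : ℂ}, ‖w‖ ≤ R / 2 → z - w ≠ 0 := fun h => by
      rw [← norm_pos_iff]; linarith [key h]
    -- Both factors of the denominator are at least `R / 2` in modulus, whence the constant `8`.
    have hdiff : herglotzRieszKernel 0 w₁ z - herglotzRieszKernel 0 w₂ z =
        2 * z * (w₁ - w₂) / ((z - w₁) * (z - w₂)) := by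
      have := hne h₁
      have := hne h₂
      simp only [herglotzRieszKernel_def, sub_zero]
      field_simp
      ring
    have hker : |(herglotzRieszKernel 0 w₁ z).re - (herglotzRieszKernel 0 w₂ z).re| ≤
        8 * ‖w₁ - w₂‖ / R := by
      rw [← Complex.sub_re]
      refine (Complex.abs_re_le_norm _).trans ?_
      rw [hdiff, norm_div, norm_mul, norm_mul, norm_mul, hzR, Complex.norm_ofNat]
      calc 2 * R * ‖w₁ - w₂‖ / (‖z - w₁‖ * ‖z - w₂‖)
          ≤ 2 * R * ‖w₁ - w₂‖ / (R / 2 * (R / 2)) := by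
            gcongr
            · exact key h₁
            · exact key h₂
        _ = _ := by field_simp; norm_num [mul_comm]
    change |(herglotzRieszKernel 0 w₁ z).re * u z - (herglotzRieszKernel 0 w₂ z).re * u z| ≤
      8 * ‖w₁ - w₂‖ / R * |u z|
    rw [← sub_mul, abs_mul]
    gcongr

-- With `L = log (2R)` an upper bound for `x = log|z - a|`, one has `|x| ≤ 2L - x`, and by Jensen's
-- formula the mean of `x` is exactly `log R ≥ 0`.
open Metric in
theorem circleAverage_abs_log_norm_sub_le {R : ℝ} (hR : 1 ≤ R) {a : ℂ} (ha : ‖a‖ ≤ R) :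
    Real.circleAverage (fun z => |Real.log ‖z - a‖|) 0 R ≤ 2 * Real.log (2 * R) := by
  have h0 : 0 < R := by linarith
  have hlog : 0 ≤ Real.log R := Real.log_nonneg hR
  have hI := circleIntegrable_log_norm_sub_const (a := a) (c := 0) R
  have hav : Real.circleAverage (fun z => Real.log ‖z - a‖) 0 R = Real.log R :=
    circleAverage_log_norm_sub_const_of_mem_closedBall (by simpa [abs_of_pos h0] using ha)
  have hle : Real.circleAverage (fun z => |Real.log ‖z - a‖|) 0 R ≤
      Real.circleAverage (fun z => 2 * Real.log (2 * R) - Real.log ‖z - a‖) 0 R := by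
    refine Real.circleAverage_mono hI.abs ((circleIntegrable_const _ _ _).sub hI) ?_
    intro z hz
    have hz' : ‖z‖ = R := by simpa [abs_of_pos h0] using hz
    have hup : Real.log ‖z - a‖ ≤ Real.log (2 * R) := by
      rcases eq_or_ne (z - a) 0 with h | h
      · rw [h, norm_zero, Real.log_zero]
        exact Real.log_nonneg (by linarith)
      · exact Real.log_le_log (norm_pos_iff.2 h) (by linarith [norm_sub_le z a])
    have h2 : 0 ≤ Real.log (2 * R) := Real.log_nonneg (by linarith)
    rw [abs_le]
    constructor <;> linarith
  refine hle.trans ?_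
  rw [Real.circleAverage_fun_sub (circleIntegrable_const _ _ _) hI, hav,
    Real.circleAverage_const]
  linarith

/-- The quotient of the moduli is at most `1 + x` with `x = n / |y - Im a|`, and `log (1 + x) ≤ x ^
α / α`. For `α < 1` the resulting kernel is locally integrable in `y`. -/
theorem abs_log_norm_sub_sub_log_norm_sub_le {w₁ w₂ a : ℂ} {y n α : ℝ} (hα : 0 < α) (hα1 : α ≤ 1)
    (h₁ : w₁.im = y) (h₂ : w₂.im = y) (ha : a.im ≠ y) (hn : ‖w₁ - w₂‖ ≤ n) :
    |Real.log ‖w₁ - a‖ - Real.log ‖w₂ - a‖| ≤ n ^ α / α * |y - a.im| ^ (-α) := by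
  have hy : 0 < |y - a.im| := abs_pos.2 (sub_ne_zero.2 ha.symm)
  have hn0 : 0 ≤ n := (norm_nonneg _).trans hn
  have one_side : ∀ v w : ℂ, v.im = y → w.im = y → ‖v - w‖ ≤ n →
      Real.log ‖v - a‖ - Real.log ‖w - a‖ ≤ n ^ α / α * |y - a.im| ^ (-α) := by
    intro v w hv hw hvw
    have hv' : |y - a.im| ≤ ‖v - a‖ := by
      simpa [hv] using Complex.abs_im_le_norm (v - a)
    have hw' : |y - a.im| ≤ ‖w - a‖ := by
      simpa [hw] using Complex.abs_im_le_norm (w - a)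
    have hvp : 0 < ‖v - a‖ := hy.trans_le hv'
    have hwp : 0 < ‖w - a‖ := hy.trans_le hw'
    set x := n / |y - a.im| with hx
    have hx0 : 0 ≤ x := by positivity
    have h1 : ‖v - a‖ / ‖w - a‖ ≤ 1 + x := by
      rw [div_le_iff₀ hwp]
      have : ‖v - a‖ ≤ ‖v - w‖ + ‖w - a‖ := norm_sub_le_norm_sub_add_norm_sub v w a
      have : n ≤ x * ‖w - a‖ := by
        rw [hx, div_mul_eq_mul_div, le_div_iff₀ hy]
        gcongr
      linarith
    rw [← Real.log_div hvp.ne' hwp.ne']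
    have h2 : (1 + x) ^ α ≤ 1 + x ^ α := by
      simpa using Real.rpow_add_le_add_rpow (by norm_num : (0:ℝ) ≤ 1) hx0 hα.le hα1
    have h3 : α * Real.log (1 + x) ≤ x ^ α := by
      rw [← Real.log_rpow (by positivity)]
      have := Real.log_le_sub_one_of_pos (show 0 < (1 + x) ^ α by positivity)
      linarith
    calc Real.log (‖v - a‖ / ‖w - a‖) ≤ Real.log (1 + x) := Real.log_le_log (by positivity) h1
      _ ≤ x ^ α / α := by rw [le_div_iff₀ hα]; linarith
      _ = _ := by
        rw [hx, Real.div_rpow hn0 hy.le, Real.rpow_neg hy.le]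
        field_simp
  rw [abs_le]
  constructor
  · have := one_side w₂ w₁ h₂ h₁ (by rwa [norm_sub_rev])
    linarith
  · exact one_side w₁ w₂ h₁ h₂ hn

/-! ### Splitting off zeros and poles -/

open Metric MeromorphicOn Function InnerProductSpace Real in
/-- The logarithm of the modulus of a meromorphic function of slow growth oscillates little, up to
the contribution of the zeros and poles. -/
theorem Meromorphic.exists_abs_log_norm_sub_log_norm_le {f : ℂ → ℂ} (hf : Meromorphic f)
    (hne : ∀ z, meromorphicOrderAt f z ≠ ⊤) {R : ℝ} (hR : 1 ≤ R) :
    ∃ (B : Set ℂ) (s : Finset ℂ) (d : ℂ → ℝ), B.Countable ∧ (∀ u, 0 ≤ d u) ∧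
      (∑ u ∈ s, d u) * Real.log 2 ≤
        ValueDistribution.logCounting f 0 (2 * R) + ValueDistribution.logCounting f ⊤ (2 * R) ∧
      ∀ w₁ w₂ : ℂ, ‖w₁‖ ≤ R / 2 → ‖w₂‖ ≤ R / 2 → w₁ ∉ B → w₂ ∉ B →
        |Real.log ‖f w₁‖ - Real.log ‖f w₂‖| ≤
          ∑ u ∈ s, d u * |Real.log ‖w₁ - u‖ - Real.log ‖w₂ - u‖| +
          8 * ‖w₁ - w₂‖ / R *
            (ValueDistribution.proximity f ⊤ R + ValueDistribution.proximity f 0 R +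
              (∑ u ∈ s, d u) * (2 * Real.log (2 * R))) := by
  have hR0 : 0 < R := by linarith
  have habs : |R| = R := abs_of_pos hR0
  set U : Set ℂ := closedBall (0 : ℂ) |R| with hU
  have hfU : MeromorphicOn f U := fun z _ => hf z
  have hfin : (divisor f U).support.Finite :=
    (divisor f U).finiteSupport (isCompact_closedBall 0 |R|)
  obtain ⟨g, hgan, hg0, hfg⟩ := hfU.extract_zeros_poles (fun u => hne u) hfin
  have hlog := MeromorphicOn.extract_zeros_poles_log hg0 hfg
  set s : Finset ℂ := hfin.toFinset with hs
  have hsU : ∀ u ∈ s, ‖u‖ ≤ R := fun u hu => by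
    have : u ∈ U := (divisor f U).supportWithinDomain (by simpa [hs] using hu)
    simpa [hU, habs] using this
  have hDU : ∀ u ∈ s, divisor f U u = divisor f Set.univ u := fun u hu => by
    rw [hU, Function.locallyFinsuppWithin.toClosedBall_divisor hf]
    exact Function.locallyFinsuppWithin.toClosedBall_eval_within _
      (by simpa [habs] using hsU u hu)
  set D : ℂ → ℝ := fun u => (divisor f Set.univ u : ℝ) with hD
  have hlog' : ∀ᶠ z in codiscreteWithin U,
      Real.log ‖f z‖ = ∑ u ∈ s, D u * Real.log ‖z - u‖ + Real.log ‖g z‖ := by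
    filter_upwards [hlog] with z hz
    rw [hz, finsum_eq_sum_of_support_subset (s := s)]
    · simp only [Pi.add_apply, Finset.sum_apply]
      congr 1
      refine Finset.sum_congr rfl fun u hu => ?_
      rw [hD]
      simp only
      rw [← hDU u hu]
    · intro u hu
      have : divisor f U u ≠ 0 := by
        intro h; apply hu; ext z; simp [h]
      simpa [hs] using this
  have hharm : HarmonicOnNhd (fun z => Real.log ‖g z‖) (closedBall 0 R) := fun z hz =>
    (hgan z (by rwa [hU, habs])).harmonicAt_log_norm (hg0 ⟨z, by rwa [hU, habs]⟩)
  have hIf : CircleIntegrable (fun z => Real.log ‖f z‖) 0 R :=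
    MeromorphicOn.circleIntegrable_log_norm fun z _ => hf z
  have hIu : ∀ u, CircleIntegrable (fun z => |D u| * |Real.log ‖z - u‖|) 0 R := fun u =>
    (circleIntegrable_log_norm_sub_const (a := u) (c := 0) R).abs.const_fun_smul (a := |D u|)
  have hIsum : CircleIntegrable (fun z => ∑ u ∈ s, |D u| * |Real.log ‖z - u‖|) 0 R :=
    CircleIntegrable.fun_sum _ fun u _ => hIu u
  have hg_avg : circleAverage (fun z => |Real.log ‖g z‖|) 0 R ≤
      ValueDistribution.proximity f ⊤ R + ValueDistribution.proximity f 0 R +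
              (∑ u ∈ s, |D u|) * (2 * Real.log (2 * R)) := by
    have h1 : circleAverage (fun z => |Real.log ‖g z‖|) 0 R =
        circleAverage (fun z => |Real.log ‖f z‖ - ∑ u ∈ s, D u * Real.log ‖z - u‖|) 0 R := by
      refine circleAverage_congr_codiscreteWithin ?_ hR0.ne'
      filter_upwards [hlog'.filter_mono (codiscreteWithin_mono sphere_subset_closedBall)] with z hz
      rw [hz, add_sub_cancel_left]
    have hIu' : CircleIntegrable (fun z => ∑ u ∈ s, D u * Real.log ‖z - u‖) 0 R :=
      CircleIntegrable.fun_sum _ fun u _ =>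
        (circleIntegrable_log_norm_sub_const (a := u) (c := 0) R).const_fun_smul (a := D u)
    have h2 : circleAverage (fun z => |Real.log ‖f z‖ - ∑ u ∈ s, D u * Real.log ‖z - u‖|) 0 R ≤
        circleAverage (fun z => |Real.log ‖f z‖| + ∑ u ∈ s, |D u| * |Real.log ‖z - u‖|) 0 R := by
      refine circleAverage_mono (hIf.sub hIu').abs (hIf.abs.add hIsum) fun z _ => ?_
      refine (abs_sub _ _).trans (add_le_add le_rfl ((Finset.abs_sum_le_sum_abs _ _).trans ?_))
      simp [abs_mul]
    -- This is `|log t| = log⁺ t + log⁺ (1 / t)`, averaged.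
    have h3 : circleAverage (fun z => |Real.log ‖f z‖|) 0 R =
        ValueDistribution.proximity f ⊤ R + ValueDistribution.proximity f 0 R := by
      rw [ValueDistribution.proximity_top, ← ValueDistribution.proximity_inv,
        ValueDistribution.proximity_top, ← circleAverage_add]
      · congr 1
        ext z
        simp only [Pi.add_apply, Pi.inv_apply, norm_inv]
        rw [Real.posLog, Real.posLog, Real.log_inv]
        rcases le_total 0 (Real.log ‖f z‖) with h | h
        · rw [abs_of_nonneg h, max_eq_right h, max_eq_left (by linarith), add_zero]
        · rw [abs_of_nonpos h, max_eq_left h, max_eq_right (by linarith), zero_add]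
      · exact MeromorphicOn.circleIntegrable_posLog_norm fun z _ => hf z
      · exact MeromorphicOn.circleIntegrable_posLog_norm fun z _ => (hf z).inv
    rw [h1]
    refine h2.trans ?_
    rw [circleAverage_fun_add (f₁ := fun z => |Real.log ‖f z‖|) hIf.abs hIsum, h3, circleAverage_fun_sum fun u _ => hIu u,
      Finset.sum_mul]
    refine add_le_add le_rfl (Finset.sum_le_sum fun u hu => ?_)
    have := circleAverage_fun_smul (a := |D u|) (f := fun z => |Real.log ‖z - u‖|) (c := 0) (R := R)
    simp only [smul_eq_mul] at this
    rw [this]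
    exact mul_le_mul_of_nonneg_left (circleAverage_abs_log_norm_sub_le hR (hsU u hu)) (abs_nonneg _)
  refine ⟨U \ {z | Real.log ‖f z‖ = ∑ u ∈ s, D u * Real.log ‖z - u‖ + Real.log ‖g z‖}, s,
    fun u => |D u|, Set.Countable.sdiff_of_mem_codiscreteWithin hlog', fun u => abs_nonneg _, ?_, ?_⟩
  -- `|D|` is the positive part (zeros) plus the negative part (poles).
  · rw [ValueDistribution.logCounting_zero, ValueDistribution.logCounting_top, ← Pi.add_apply,
      ← map_add, Finset.sum_mul]
    refine le_trans (le_of_eq ?_)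
      (Function.locallyFinsuppWithin.sum_mul_log_two_le_logCounting (by positivity) hR hsU)
    refine Finset.sum_congr rfl fun u _ => ?_
    rw [← posPart_add_negPart (D u)]
    simp [hD, posPart_def, negPart_def]
  · intro w₁ w₂ h₁ h₂ hB₁ hB₂
    have hmem : ∀ {w : ℂ}, ‖w‖ ≤ R / 2 → w ∈ U := fun h => by
      simpa [hU, habs] using h.trans (by linarith)
    have e₁ : Real.log ‖f w₁‖ = ∑ u ∈ s, D u * Real.log ‖w₁ - u‖ + Real.log ‖g w₁‖ := by
      by_contra h; exact hB₁ ⟨hmem h₁, h⟩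
    have e₂ : Real.log ‖f w₂‖ = ∑ u ∈ s, D u * Real.log ‖w₂ - u‖ + Real.log ‖g w₂‖ := by
      by_contra h; exact hB₂ ⟨hmem h₂, h⟩
    have hh := hharm.abs_sub_le_mul_circleAverage_abs hR0 h₁ h₂
    rw [e₁, e₂, add_sub_add_comm, ← Finset.sum_sub_distrib]
    refine (abs_add_le _ _).trans (add_le_add ((Finset.abs_sum_le_sum_abs _ _).trans ?_)
      (hh.trans (mul_le_mul_of_nonneg_left hg_avg (by positivity))))
    refine Finset.sum_le_sum fun u _ => ?_
    rw [← mul_sub, abs_mul]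

/-! ### Choosing a good height -/

open MeasureTheory Set in
theorem Real.rpow_neg_le_indicator_add {α M x : ℝ} (hα : 0 < α) (hM : 0 < M) (hx : 0 ≤ x) :
    x ^ (-α) ≤ (Ioc 0 M).indicator (fun s : ℝ => s ^ (-α)) x + M ^ (-α) := by
  by_cases h : x ∈ Ioc 0 M
  · rw [indicator_of_mem h]
    have : 0 ≤ M ^ (-α) := by positivity
    linarith
  · rw [indicator_of_notMem h, zero_add]
    rcases hx.eq_or_lt with rfl | hx'
    · rw [Real.zero_rpow (by linarith)]; positivity
    · have : M < x := by
        by_contra h'; exact h ⟨hx', not_lt.1 h'⟩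
      exact Real.rpow_le_rpow_of_nonpos hM this.le (by linarith)

open MeasureTheory Set in
/-- First moment method: for weighted points of total mass `W` there is a point of `[M, 2M]` at
which the potential with kernel `|y - t| ^ (-α)` is at most a constant times `W M ^ (-α)`. -/
theorem exists_sum_mul_abs_sub_rpow_neg_le {ι : Type*} (s : Finset ι) (c t : ι → ℝ)
    (hc : ∀ i, 0 ≤ c i) {α M : ℝ} (hα : 0 < α) (hα1 : α < 1) (hM : 0 < M) {E : Set ℝ}
    (hE : E.Countable) :
    ∃ y ∈ Icc M (2 * M), y ∉ E ∧
      ∑ i ∈ s, c i * |y - t i| ^ (-α) ≤ (∑ i ∈ s, c i) * ((2 / (1 - α) + 1) * M ^ (-α)) := by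
  set F : ℝ → ℝ := (Ioc 0 M).indicator (fun s : ℝ => s ^ (-α)) with hF
  have hFnn : ∀ x, 0 ≤ F x := fun x => by
    refine indicator_nonneg (fun s hs => ?_) x
    exact Real.rpow_nonneg hs.1.le _
  have hFi : Integrable F := by
    rw [hF, integrable_indicator_iff measurableSet_Ioc,
      ← intervalIntegrable_iff_integrableOn_Ioc_of_le hM.le]
    exact intervalIntegral.intervalIntegrable_rpow' (by linarith)
  have hFint : ∫ x, F |x| = 2 * (M ^ (1 - α) / (1 - α)) := by
    rw [integral_comp_abs, hF, setIntegral_indicator measurableSet_Ioc,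
      inter_eq_self_of_subset_right Ioc_subset_Ioi_self,
      ← intervalIntegral.integral_of_le hM.le, integral_rpow (Or.inl (by linarith)),
      Real.zero_rpow (by linarith), sub_zero, neg_add_eq_sub]
  -- A non-integrable function has integral `0` by convention, but this integral is positive.
  have hFabs : Integrable fun x => F |x| := by
    by_contra h
    have h0 := integral_undef h
    rw [hFint] at h0
    have : 0 < M ^ (1 - α) / (1 - α) := div_pos (by positivity) (by linarith)
    linarith
  have hFt : ∀ i, Integrable fun y => c i * F |y - t i| := fun i =>
    (hFabs.comp_sub_right (t i)).const_mul _
  set G : ℝ → ℝ := fun y => ∑ i ∈ s, c i * F |y - t i| with hG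
  have hGnn : ∀ y, 0 ≤ G y := fun y =>
    Finset.sum_nonneg fun i _ => mul_nonneg (hc i) (hFnn _)
  have hGi : Integrable G := integrable_finsetSum _ fun i _ => hFt i
  have hGint : ∫ y, G y = (∑ i ∈ s, c i) * (2 * (M ^ (1 - α) / (1 - α))) := by
    rw [hG, integral_finsetSum _ fun i _ => hFt i, Finset.sum_mul]
    refine Finset.sum_congr rfl fun i _ => ?_
    rw [integral_const_mul, integral_sub_right_eq_self (fun x => F |x|) (t i), hFint]
  have hvol : volume.real (Icc M (2 * M)) = M := by
    rw [Real.volume_real_Icc_of_le (by linarith)]; ring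
  have hrne : volume.restrict (Icc M (2 * M)) ≠ 0 := by
    intro h
    have h' := Measure.restrict_eq_zero.1 h
    rw [Real.volume_Icc, ENNReal.ofReal_eq_zero] at h'
    linarith
  have hnull : volume.restrict (Icc M (2 * M)) (E ∪ (Icc M (2 * M))ᶜ) = 0 := by
    refine measure_union_null (hE.measure_zero _) ?_
    rw [Measure.restrict_apply measurableSet_Icc.compl, compl_inter_self, measure_empty]
  have : IsFiniteMeasure (volume.restrict (Icc M (2 * M))) :=
    ⟨by rw [Measure.restrict_apply_univ]; exact measure_Icc_lt_top⟩
  obtain ⟨y, hyN, hy⟩ := exists_notMem_null_le_average hrne hGi.restrict hnull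
  rw [mem_union, not_or, mem_compl_iff, not_not] at hyN
  refine ⟨y, hyN.2, hyN.1, ?_⟩
  rw [setAverage_eq, hvol, smul_eq_mul] at hy
  have hyG : G y ≤ (∑ i ∈ s, c i) * (2 / (1 - α) * M ^ (-α)) := by
    calc G y ≤ M⁻¹ * ∫ y in Icc M (2 * M), G y := hy
      _ ≤ M⁻¹ * ∫ y, G y := by
        gcongr
        · exact ae_of_all _ hGnn
        · exact Measure.restrict_le_self
      _ = _ := by
        rw [hGint, sub_eq_add_neg, Real.rpow_add hM, Real.rpow_one]
        field_simp
  calc ∑ i ∈ s, c i * |y - t i| ^ (-α)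
      ≤ ∑ i ∈ s, (c i * F |y - t i| + c i * M ^ (-α)) := by
        refine Finset.sum_le_sum fun i _ => ?_
        rw [← mul_add]
        exact mul_le_mul_of_nonneg_left
          (Real.rpow_neg_le_indicator_add hα hM (abs_nonneg _)) (hc i)
    _ = G y + (∑ i ∈ s, c i) * M ^ (-α) := by
        rw [Finset.sum_add_distrib, Finset.sum_mul]
    _ ≤ _ := by
        have : (∑ i ∈ s, c i) * ((2 / (1 - α) + 1) * M ^ (-α)) =
          (∑ i ∈ s, c i) * (2 / (1 - α) * M ^ (-α)) + (∑ i ∈ s, c i) * M ^ (-α) := by ring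
        linarith

/-! ### Comparable shifts for slow growth -/

open ValueDistribution in
theorem Meromorphic.exists_characteristic_zero_le {f : ℂ → ℂ} (hf : Meromorphic f) :
    ∃ K : ℝ, 0 ≤ K ∧ ∀ r, characteristic f 0 r ≤ characteristic f ⊤ r + K := by
  refine ⟨max |Real.log ‖f 0‖| |Real.log ‖meromorphicTrailingCoeffAt f 0‖|, by positivity,
    fun r => ?_⟩
  have h : characteristic f⁻¹ ⊤ = characteristic f 0 := by
    simp [characteristic, proximity_inv, logCounting_inv]
  have := (abs_le.1 (characteristic_sub_characteristic_inv_le hf (R := r))).1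
  rw [h] at this
  linarith

open Topology in
theorem tendsto_growth_majorant_zero {ρ α : ℝ} (hρ : 0 < ρ) (hρα : ρ < α) (hα : α < 1)
    (a b c K : ℝ) :
    Tendsto (fun M : ℝ => a * ((2 * (12 * M) ^ ρ + K) * M ^ (-α)) +
      b * ((2 * (12 * M) ^ ρ + K) / M * (1 + c * Real.log (2 * (6 * M))))) atTop (𝓝 0) := by
  have h1 : Tendsto (fun M : ℝ => (2 * (12 * M) ^ ρ + K) * M ^ (-α)) atTop (𝓝 0) := by
    have e1 : Tendsto (fun M : ℝ => 2 * 12 ^ ρ * M ^ (-(α - ρ)) + K * M ^ (-α)) atTop (𝓝 0) := by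
      simpa using ((tendsto_rpow_neg_atTop (sub_pos.2 hρα)).const_mul (2 * 12 ^ ρ : ℝ)).add
        ((tendsto_rpow_neg_atTop (hρ.trans hρα)).const_mul K)
    refine e1.congr' ?_
    filter_upwards [eventually_gt_atTop 0] with M hM
    rw [Real.mul_rpow (by norm_num) hM.le, show -(α - ρ) = ρ + -α by ring, Real.rpow_add hM]
    ring
  have h2 : Tendsto (fun M : ℝ => (1 + c * Real.log (2 * (6 * M))) * M ^ (-(1 - α)))
      atTop (𝓝 0) := by
    have hlog : Tendsto (fun M : ℝ => Real.log M * M ^ (-(1 - α))) atTop (𝓝 0) := by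
      refine ((isLittleO_log_rpow_atTop (sub_pos.2 hα)).tendsto_div_nhds_zero).congr' ?_
      filter_upwards [eventually_gt_atTop 0] with M hM
      rw [Real.rpow_neg hM.le, div_eq_mul_inv]
    have e1 : Tendsto (fun M : ℝ => (1 + c * Real.log 12) * M ^ (-(1 - α)) +
        c * (Real.log M * M ^ (-(1 - α)))) atTop (𝓝 0) := by
      simpa using ((tendsto_rpow_neg_atTop (sub_pos.2 hα)).const_mul (1 + c * Real.log 12)).add
        (hlog.const_mul c)
    refine e1.congr' ?_
    filter_upwards [eventually_gt_atTop 0] with M hM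
    rw [show 2 * (6 * M) = 12 * M by ring, Real.log_mul (by norm_num) hM.ne']
    ring
  have h3 := (h1.const_mul a).add ((h1.mul h2).const_mul b)
  simp only [mul_zero, add_zero] at h3
  refine h3.congr' ?_
  filter_upwards [eventually_gt_atTop 0] with M hM
  -- The first factor absorbs the growth `M ^ ρ`, the second the logarithm.
  have : M ^ (-α) * M ^ (-(1 - α)) = M⁻¹ := by
    rw [← Real.rpow_add hM, ← Real.rpow_neg_one]; congr 1; ring
  rw [div_eq_mul_inv, ← this]
  ring

open ValueDistribution Complex in
/-- A meromorphic function whose characteristic is `O(r ^ ρ)` with `ρ < 1` has, arbitrarily far out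
on the imaginary axis, shifts of comparable modulus. -/
theorem Meromorphic.eventually_exists_abs_log_norm_shift_sub_le {f : ℂ → ℂ} (hf : Meromorphic f)
    (hne : ∀ z, meromorphicOrderAt f z ≠ ⊤) {ρ : ℝ} (hρ : 0 < ρ) (hρ1 : ρ < 1)
    (hT : ∀ᶠ r in atTop, characteristic f ⊤ r ≤ r ^ ρ) {N : Set ℂ} (hN : N.Countable) (n : ℕ) :
    ∀ᶠ M : ℝ in atTop, ∃ y : ℝ, M ≤ y ∧ (∀ j ≤ n, (y * I + (j : ℂ)) ∉ N) ∧
      ∀ j ≤ n, ∀ k ≤ n,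
        |Real.log ‖f (y * I + (j : ℂ))‖ - Real.log ‖f (y * I + (k : ℂ))‖| ≤ 1 := by
  obtain ⟨K, hK0, hK⟩ := hf.exists_characteristic_zero_le
  obtain ⟨α, hρα, hα1⟩ := exists_between hρ1
  have hα0 : 0 < α := hρ.trans hρα
  set c₁ : ℝ := (n : ℝ) ^ α / α with hc₁
  set c₂ : ℝ := 2 / (1 - α) + 1 with hc₂
  have hc₁0 : 0 ≤ c₁ := by positivity
  have hc₂0 : 0 ≤ c₂ := by
    have : 0 < 1 - α := by linarith
    positivity
  have hlim := tendsto_growth_majorant_zero hρ hρα hα1 (2 * c₁ * c₂) (8 * n / 6) 4 K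
  obtain ⟨r₀, hr₀⟩ := eventually_atTop.1 hT
  filter_upwards [hlim.eventually (eventually_le_nhds zero_lt_one), eventually_ge_atTop 1,
    eventually_ge_atTop r₀, eventually_ge_atTop (n : ℝ)] with M hM hM1 hMr hMn
  have hM0 : 0 < M := by linarith
  set A : ℝ := 2 * (12 * M) ^ ρ + K with hA
  have hA0 : 0 ≤ A := by positivity
  -- Since `y ≤ 2M` and `n ≤ M`, the shifts lie in `|z| ≤ 3M = R / 2`.
  set R : ℝ := 6 * M with hR
  have hR1 : 1 ≤ R := by linarith
  have hchar : ∀ r, r₀ ≤ r → 1 ≤ r → r ≤ 12 * M →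
      characteristic f 0 r + characteristic f ⊤ r ≤ A := by
    intro r h1 h2 h3
    have := hr₀ r h1
    have := hK r
    have : r ^ ρ ≤ (12 * M) ^ ρ := Real.rpow_le_rpow (by linarith) h3 hρ.le
    linarith
  have hprox : proximity f ⊤ R + proximity f 0 R ≤ A := by
    have := hchar R (by linarith) hR1 (by linarith)
    simp only [characteristic, Pi.add_apply] at this
    linarith [logCounting_nonneg (f := f) (e := ⊤) hR1, logCounting_nonneg (f := f) (e := 0) hR1]
  have hcount : logCounting f 0 (2 * R) + logCounting f ⊤ (2 * R) ≤ A := by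
    have := hchar (2 * R) (by linarith) (by linarith) (by linarith)
    simp only [characteristic, Pi.add_apply] at this
    have h1 := proximity_nonneg (f := f) (a := ⊤) (2 * R)
    have h2 := proximity_nonneg (f := f) (a := 0) (2 * R)
    simp only [Pi.zero_apply] at h1 h2
    linarith
  obtain ⟨B, s, d, hB, hd, hW, hosc⟩ := hf.exists_abs_log_norm_sub_log_norm_le hne hR1
  set W : ℝ := ∑ u ∈ s, d u with hWdef
  have hW0 : 0 ≤ W := Finset.sum_nonneg fun u _ => hd u
  have hWA : W ≤ 2 * A := by
    have := Real.log_two_gt_d9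
    nlinarith
  -- Heights to avoid: those where a shift meets an exceptional set, or which equal the imaginary
  -- part of a zero or pole in `s`.
  set E : Set ℝ := (⋃ j : ℕ, (fun y : ℝ => (y * I + (j : ℂ))) ⁻¹' (B ∪ N)) ∪
    (fun u : ℂ => u.im) '' s with hE
  have hEc : E.Countable := by
    refine (Set.countable_iUnion fun j => (hB.union hN).preimage ?_).union
      (s.countable_toSet.image _)
    intro x y hxy
    simpa using hxy
  obtain ⟨y, hy, hyE, hsum⟩ :=
    exists_sum_mul_abs_sub_rpow_neg_le s d (fun u => u.im) hd hα0 hα1 hM0 hEc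
  have hyj : ∀ j : ℕ, (y * I + (j : ℂ)) ∉ B ∪ N := fun j hj =>
    hyE (Or.inl (Set.mem_iUnion.2 ⟨j, hj⟩))
  have hyu : ∀ u ∈ s, u.im ≠ y := fun u hu h => hyE (Or.inr ⟨u, hu, h⟩)
  have him : ∀ j : ℕ, (y * I + (j : ℂ)).im = y := by simp
  have hnorm : ∀ j ≤ n, ‖(y * I + (j : ℂ))‖ ≤ R / 2 := by
    intro j hj
    have h1 : (j : ℝ) ≤ n := by exact_mod_cast hj
    have h2 : ‖(y * I : ℂ)‖ = y := by simp [abs_of_pos (hM0.trans_le hy.1)]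
    have h3 := norm_add_le (y * I : ℂ) (j : ℂ)
    rw [h2, norm_natCast] at h3
    linarith [hy.2]
  refine ⟨y, hy.1, fun j _ h => hyj j (Or.inr h), fun j hj k hk => ?_⟩
  have hjk : ‖(y * I + (j : ℂ)) - (y * I + (k : ℂ))‖ ≤ n := by
    rw [add_sub_add_left_eq_sub, ← ofReal_natCast, ← ofReal_natCast, ← ofReal_sub,
      norm_real, Real.norm_eq_abs, abs_le]
    have h1 : (j : ℝ) ≤ n := by exact_mod_cast hj
    have h2 : (k : ℝ) ≤ n := by exact_mod_cast hk
    have h3 : (0 : ℝ) ≤ j := Nat.cast_nonneg _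
    have h4 : (0 : ℝ) ≤ k := Nat.cast_nonneg _
    constructor <;> linarith
  refine (hosc _ _ (hnorm j hj) (hnorm k hk) (fun h => hyj j (Or.inl h))
    (fun h => hyj k (Or.inl h))).trans (le_trans (add_le_add ?_ ?_) hM)
  · calc ∑ u ∈ s, d u * |Real.log ‖(y * I + (j : ℂ)) - u‖ - Real.log ‖(y * I + (k : ℂ)) - u‖|
        ≤ ∑ u ∈ s, d u * (c₁ * |y - u.im| ^ (-α)) := by
          refine Finset.sum_le_sum fun u hu => mul_le_mul_of_nonneg_left ?_ (hd u)
          exact abs_log_norm_sub_sub_log_norm_sub_le hα0 hα1.le (him j) (him k) (hyu u hu) hjk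
      _ = c₁ * ∑ u ∈ s, d u * |y - u.im| ^ (-α) := by
          rw [Finset.mul_sum]
          exact Finset.sum_congr rfl fun u _ => by ring
      _ ≤ c₁ * (W * (c₂ * M ^ (-α))) := by gcongr
      _ ≤ c₁ * (2 * A * (c₂ * M ^ (-α))) := by gcongr
      _ = _ := by ring
  · have hlog : 0 ≤ Real.log (2 * R) := Real.log_nonneg (by linarith)
    have hp₁ := proximity_nonneg (f := f) (a := ⊤) R
    have hp₂ := proximity_nonneg (f := f) (a := 0) R
    simp only [Pi.zero_apply] at hp₁ hp₂
    calc _ ≤ 8 * n / R * (A + 2 * A * (2 * Real.log (2 * R))) := by gcongr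
      _ = _ := by rw [hR]; field_simp; ring

/-! ### The difference equation -/

theorem meromorphicOrderAt_ne_top_of_not_meromorphicEq_zero {f : ℂ → ℂ} (hf : Meromorphic f)
    (hf0 : ¬ MeromorphicEq f (fun _ => 0)) (z : ℂ) : meromorphicOrderAt f z ≠ ⊤ := by
  refine hf.exists_meromorphicOrderAt_ne_top_iff_forall.1 ?_ z
  by_contra! h
  refine hf0 ?_
  rw [MeromorphicEq, EventuallyEq, eventually_iff, mem_codiscrete]
  intro x
  rw [disjoint_principal_right, compl_compl]
  exact meromorphicOrderAt_eq_top_iff.1 (h x)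

theorem exists_characteristic_le_rpow_of_nevanlinnaOrder_lt_one {f : ℂ → ℂ}
    (h : nevanlinnaOrder f < 1) :
    ∃ ρ : ℝ, 0 < ρ ∧ ρ < 1 ∧
      ∀ᶠ r in atTop, ValueDistribution.characteristic f ⊤ r ≤ r ^ ρ := by
  obtain ⟨b, hb, hb1⟩ := EReal.lt_iff_exists_real_btwn.1 h
  have hb1' : b < 1 := by exact_mod_cast hb1
  obtain ⟨ρ, hρ, hρ1⟩ := exists_between (max_lt hb1' one_pos)
  rw [max_lt_iff] at hρ
  refine ⟨ρ, hρ.2, hρ1, ?_⟩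
  filter_upwards [eventually_lt_of_limsup_lt hb, eventually_gt_atTop 1] with r hr hr1
  have hlog : 0 < Real.log r := Real.log_pos hr1
  have hr' : Real.posLog (ValueDistribution.characteristic f ⊤ r) / Real.log r < b := by
    exact_mod_cast hr
  rw [div_lt_iff₀ hlog] at hr'
  rcases le_or_gt (ValueDistribution.characteristic f ⊤ r) 0 with h0 | h0
  · exact h0.trans (by positivity)
  · rw [← Real.log_le_log_iff h0 (by positivity), Real.log_rpow (by linarith)]
    have h1 : Real.log (ValueDistribution.characteristic f ⊤ r) ≤
        Real.posLog (ValueDistribution.characteristic f ⊤ r) := le_max_right _ _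
    nlinarith [hρ.1]

open Complex in
theorem corollary7p2 (n : ℕ) (Q : Fin (n + 1) → ℂ[X]) (l : Fin (n + 1))
    (hQ : (Finset.univ.erase l).sup (fun j => (Q j).degree) < (Q l).degree)
    (f : ℂ → ℂ) (hf : Meromorphic f) (hf0 : ¬ MeromorphicEq f (fun _ => 0))
    (heq : MeromorphicEq
      (fun z => ∑ j : Fin (n + 1), (Q j).eval z * f (z + ((j : ℕ) : ℂ))) (fun _ => 0)) :
    1 ≤ nevanlinnaOrder f := by
  by_contra! hlt
  obtain ⟨ρ, hρ, hρ1, hT⟩ := exists_characteristic_le_rpow_of_nevanlinnaOrder_lt_one hlt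
  have hne := meromorphicOrderAt_ne_top_of_not_meromorphicEq_zero hf hf0
  have hfne : ∀ᶠ z in codiscrete ℂ, f z ≠ 0 :=
    MeromorphicOn.eventually_codiscreteWithin_apply_ne_zero (U := Set.univ)
      (fun z _ => hf z) fun z _ => hne z
  have hN := Set.Countable.sdiff_of_mem_codiscreteWithin (hfne.and heq)
  have hosc := hf.eventually_exists_abs_log_norm_shift_sub_le hne hρ hρ1 hT hN n
  have hQl : Q l ≠ 0 := ne_zero_of_degree_gt hQ
  -- The `n` other terms then sum to at most `n / (n + 1)` times the dominant one.
  set ε : ℝ := (Real.exp 1 * (n + 1))⁻¹ with hε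
  have hε0 : 0 < ε := by positivity
  have hsmall : ∀ᶠ z in Bornology.cobounded ℂ, ∀ j ∈ Finset.univ.erase l,
      ‖(Q j).eval z‖ ≤ ε * ‖(Q l).eval z‖ := by
    rw [eventually_all_finset]
    intro j hj
    exact (isLittleO_cobounded_of_degree_lt
      ((Finset.le_sup (f := fun j => (Q j).degree) hj).trans_lt hQ)).bound hε0
  have hroot : ∀ᶠ z in Bornology.cobounded ℂ, (Q l).eval z ≠ 0 := by
    have := (Polynomial.finite_setOfPred_isRoot hQl).isBounded
    filter_upwards [Bornology.isBounded_def.1 this] with z hz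
    exact hz
  have hI : Tendsto (fun y : ℝ => (y * I : ℂ)) atTop (Bornology.cobounded ℂ) := by
    rw [← tendsto_norm_atTop_iff_cobounded]
    simpa using tendsto_abs_atTop_atTop
  obtain ⟨M₀, hM₀⟩ := eventually_atTop.1 (hI.eventually (hsmall.and hroot))
  obtain ⟨M, ⟨y, hMy, hyN, hylog⟩, hM⟩ := (hosc.and (eventually_ge_atTop M₀)).exists
  obtain ⟨hys, hyr⟩ := hM₀ y (hM.trans hMy)
  have hgood : ∀ j : Fin (n + 1), f (y * I + ((j : ℕ) : ℂ)) ≠ 0 ∧ _ := fun j =>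
    not_not.1 fun h => hyN j (Nat.lt_succ_iff.1 j.2) ⟨trivial, h⟩
  have hzero := (hgood 0).2
  simp only [Fin.val_zero, Nat.cast_zero, add_zero] at hzero
  rw [← Finset.add_sum_erase _ _ (Finset.mem_univ l)] at hzero
  set q := ‖(Q l).eval (y * I : ℂ)‖ with hq
  have hq0 : 0 < q := norm_pos_iff.2 hyr
  set v := ‖f (y * I + ((l : ℕ) : ℂ))‖ with hv
  have hv0 : 0 < v := norm_pos_iff.2 (hgood l).1
  have hcmp : ∀ j : Fin (n + 1), ‖f (y * I + ((j : ℕ) : ℂ))‖ ≤ Real.exp 1 * v := by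
    intro j
    have h1 := (abs_le.1 (hylog j (Nat.lt_succ_iff.1 j.2) l (Nat.lt_succ_iff.1 l.2))).2
    rw [← Real.log_le_log_iff (norm_pos_iff.2 (hgood j).1) (by positivity),
      Real.log_mul (Real.exp_ne_zero _) hv0.ne', Real.log_exp]
    linarith
  have hle : q * v ≤ n * (ε * q * (Real.exp 1 * v)) := by
    rw [hq, hv, ← norm_mul, eq_neg_of_add_eq_zero_left hzero, norm_neg]
    refine (norm_sum_le _ _).trans ?_
    refine (Finset.sum_le_card_nsmul _ _ (ε * q * (Real.exp 1 * v)) fun j hj => ?_).trans ?_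
    · rw [norm_mul]
      exact mul_le_mul (hys j hj) (hcmp j) (norm_nonneg _) (by positivity)
    · simp [Finset.card_erase_of_mem, hq, hv]
  have hlast : (n : ℝ) * (ε * q * (Real.exp 1 * v)) = n / (n + 1) * (q * v) := by
    rw [hε]
    field_simp
  rw [hlast] at hle
  have : (n : ℝ) / (n + 1) < 1 := by
    rw [div_lt_one (by positivity)]; linarith
  nlinarith [mul_pos hq0 hv0]
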